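/- Let $(M,c)$ be a conformal manifold of dimension $d\ge 3$ (any signature), let $\sigma\in\Gamma\mathcal E[1]$ be a real conformal density of weight $1$, let $I_A=\frac1d D_A\sigma$ be its scale tractor, where $D_A$ is the Thomas-D operator, and suppose that $I^2=I^AI_A$ is nowhere zero. Let $I\cdot D=I^AD_A$ be the associated degenerate Laplacian; it maps sections of $\mathcal E^\Phi[w]$ to sections of $\mathcal E^\Phi[w-1]$ for every tractor bundle $\mathcal E^\Phi$ (a tensor part of a tensor power of the standard tractor bundle) and every weight $w\in\mathbb C$. Put $x=\sigma$ and $y=-\frac1{I^2}I\cdot D$, and for $K(z)=\sum_m\alpha_mz^m\in\mathbb C[[z]]$ let $:\!K(z)\!:\,f_0=\sum_m\alpha_m\,x^my^mf_0$ be the normal-ordered formal series. Call $:\!K\!:$ a *formal solution operator* on $\mathcal E^\Phi[w_0]$ if $K(0)=1$ and, for every smooth section $f_0$ of $\mathcal E^\Phi[w_0]$ and every $\ell\ge 0$, $$I\cdot D\Big(\sum_{m\le \ell}\alpha_m x^my^mf_0\Big)=O(\sigma^{\ell}),$$ that is, equals $\sigma^\ell$ times a smooth section. For $a\in\mathbb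 C$ write $(a)_m=a(a-1)\cdots(a-m+1)$, $(a)_0=1$. Let $w_0\in\mathbb C$ with $w_0\notin\{\frac{j-d}2: j\in\mathbb Z_{\ge2}\}$ and put $h_0=d+2w_0$. Then $(m+1-h_0)_m\neq0$ for all $m\ge 0$, and $$f_0\longmapsto\sum_{m=0}^\infty \sigma^m\,\frac{1}{m!\,(m+1-h_0)_m}\Big(\frac1{I^2}\,I\cdot D\Big)^{m}f_0$$ is a formal solution operator on $\mathcal E^\Phi[w_0]$, namely $:\!K\!:$ for $K(z)=\sum_m\frac{(-z)^m}{m!(m+1-h_0)_m}$. It is the only one, provided that some smooth section of $\mathcal E^\Phi[w_0]$ does not vanish identically along the zero locus $\Sigma=\{\sigma=0\}$ (that is, provided that $\Sigma\ne\emptyset$ and $\mathcal E^\Phi$ is not the zero bundle there). If $I^2$ is constant, the $m$-th term of the series equals $\sigma^m\frac{1}{m!\,(m+1-h_0)_m\,(I^2)^m}(I\cdot D)^mf_0$. For every $z\in\mathbb C\setminus\{0\}$ (principal branches) the series $K(z)$ converges and $$K(z)=z^{\frac{h_0-1}2}\,\Gamma(2-h_0)\,J_{1-h_0}(2\sqrt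 z),$$ where $J_\nu(u)=\sum_{m\ge0}\frac{(-1)^m}{m!\,\Gamma(m+\nu+1)}\left(\frac u2\right)^{2m+\nu}$. -/

import Mathlib

open scoped Manifold ContDiff Matrix

noncomputable section

namespace DegenerateLaplacian

/-! ### Calculus in one coordinate chart and one metric of the conformal class

Everything in this part takes place on (an open subset of) the coordinate space `ℝ^d`, for a metric
given by its matrix `G` of components.  Densities are trivialised by the metric, so that the
Levi-Civita connection on densities is the coordinate derivative of the trivialised density. -/

/-- Coordinate space. -/
abbrev Coord (d : ℕ) : Type := EuclideanSpace ℝ (Fin d)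

/-- The index set of the standard tractor bundle `𝓔[1] ⊕ T*M[1] ⊕ 𝓔[-1]`: a top slot,
`d` middle slots and a bottom slot. -/
abbrev TIdx (d : ℕ) : Type := Unit ⊕ (Fin d ⊕ Unit)

/-- Components of a (complex) tractor tensor of rank `k` at a point. -/
abbrev TTensor (d k : ℕ) : Type := (Fin k → TIdx d) → ℂ

/-- Components of a tractor tensor field of rank `k`, in coordinates and in a scale. -/
abbrev TField (d k : ℕ) : Type := Coord d → TTensor d k

variable {d k : ℕ}

/-- The `i`-th partial derivative. -/
def pd {V : Type*} [NormedAddCommGroup V] [NormedSpace ℝ V] (i : Fin d) (f : Coord d → V)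
    (x : Coord d) : V :=
  fderiv ℝ f x (EuclideanSpace.single i 1)

/-- Christoffel symbols `Γ^c_{ab}` of the Levi-Civita connection of `G`. -/
def christoffel (G : Coord d → Matrix (Fin d) (Fin d) ℝ) (x : Coord d) (c a b : Fin d) : ℝ :=
  (1 / 2) * ∑ e, (G x)⁻¹ c e *
    (pd a (fun y => G y b e) x + pd b (fun y => G y a e) x - pd e (fun y => G y a b) x)

/-- The Riemann curvature `R_{ab}{}^c{}_e`, with `R(X,Y)Z = X^a Y^b Z^e R_{ab}{}^c{}_e` and
`R(X,Y) = ∇_X ∇_Y - ∇_Y ∇_X - ∇_{[X,Y]}`. -/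
def riemann (G : Coord d → Matrix (Fin d) (Fin d) ℝ) (x : Coord d) (a b c e : Fin d) : ℝ :=
  pd a (fun y => christoffel G y c b e) x - pd b (fun y => christoffel G y c a e) x
    + ∑ m, (christoffel G x c a m * christoffel G x m b e
      - christoffel G x c b m * christoffel G x m a e)

/-- The Ricci tensor `Ric_{ab} = R_{ca}{}^c{}_b`. -/
def ricci (G : Coord d → Matrix (Fin d) (Fin d) ℝ) (x : Coord d) (a b : Fin d) : ℝ :=
  ∑ c, riemann G x c a c b

/-- `J = Sc / (2(d-1))`, the trace of the Schouten tensor. -/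
def schoutenTrace (G : Coord d → Matrix (Fin d) (Fin d) ℝ) (x : Coord d) : ℝ :=
  (∑ a, ∑ b, (G x)⁻¹ a b * ricci G x a b) / (2 * ((d : ℝ) - 1))

/-- The Schouten tensor: `Ric_{ab} = (d-2) P_{ab} + J g_{ab}`. -/
def schouten (G : Coord d → Matrix (Fin d) (Fin d) ℝ) (x : Coord d) (a b : Fin d) : ℝ :=
  (ricci G x a b - schoutenTrace G x * G x a b) / ((d : ℝ) - 2)

/-- The tractor metric `h(T,T) = g^{ab} μ_a μ_b + 2 σ ρ` of `T = (σ, μ_a, ρ)`, as a matrix. -/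
def tractorMetric (G : Matrix (Fin d) (Fin d) ℝ) : Matrix (TIdx d) (TIdx d) ℝ
  | .inl _, .inr (.inr _) => 1
  | .inr (.inr _), .inl _ => 1
  | .inr (.inl a), .inr (.inl b) => G⁻¹ a b
  | _, _ => 0

/-- The matrix `A_a` of the (coupled Levi-Civita-)tractor connection in coordinates,
`∇_a T = ∂_a T + A_a T`, where for `T = (σ, μ_b, ρ)`
`∇_a T = (∇_a σ - μ_a, ∇_a μ_b + g_{ab} ρ + P_{ab} σ, ∇_a ρ - P_{ac} μ^c)`. -/
def tractorConn (G : Coord d → Matrix (Fin d) (Fin d) ℝ) (x : Coord d) (a : Fin d) :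
    Matrix (TIdx d) (TIdx d) ℝ
  | .inl _, .inr (.inl b) => if a = b then -1 else 0
  | .inr (.inl b), .inl _ => schouten G x a b
  | .inr (.inl b), .inr (.inl c) => -christoffel G x c a b
  | .inr (.inl b), .inr (.inr _) => G x a b
  | .inr (.inr _), .inr (.inl b) => -∑ c, schouten G x a c * (G x)⁻¹ c b
  | _, _ => 0

/-- The action of an endomorphism of the standard tractor space on rank `k` tensors by
derivations (sum over the slots). -/
def derivationAct (A : Matrix (TIdx d) (TIdx d) ℝ) (T : TTensor d k) : TTensor d k :=
  fun B => ∑ r, ∑ C, (A (B r) C : ℂ) * T (Function.update B r C)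

/-- The action of a linear map of the standard tractor space on rank `k` tensors
(its `k`-th tensor power). -/
def tensorPowerAct (S : Matrix (TIdx d) (TIdx d) ℝ) (T : TTensor d k) : TTensor d k :=
  fun B => ∑ C : Fin k → TIdx d, (∏ r, (S (B r) (C r) : ℂ)) * T C

/-- The coupled covariant derivative `∇_a f` of a weighted tractor tensor field. -/
def nabla (G : Coord d → Matrix (Fin d) (Fin d) ℝ) (a : Fin d) (f : TField d k) : TField d k :=
  fun x => pd a f x + derivationAct (tractorConn G x a) (f x)

/-- The coupled Laplacian `Δ f = g^{ab} ∇_a ∇_b f`. -/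
def laplacian (G : Coord d → Matrix (Fin d) (Fin d) ℝ) (f : TField d k) : TField d k :=
  fun x => ∑ a, ∑ b, (((G x)⁻¹ a b : ℝ) : ℂ) •
    (nabla G a (nabla G b f) x - ∑ c, ((christoffel G x c a b : ℝ) : ℂ) • nabla G c f x)

/-- The Thomas-D operator `D_A f` on tractor tensors of weight `w`, whose slots are
`((d+2w-2) w f, (d+2w-2) ∇_a f, -(Δ f + J w f))`. -/
def thomasD (G : Coord d → Matrix (Fin d) (Fin d) ℝ) (w : ℂ) (f : TField d k) (x : Coord d) :
    TIdx d → TTensor d k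
  | .inl _ => ((d + 2 * w - 2) * w) • f x
  | .inr (.inl a) => (d + 2 * w - 2) • nabla G a f x
  | .inr (.inr _) => -(laplacian G f x + ((schoutenTrace G x : ℂ) * w) • f x)

/-- The scale tractor `I_A = (1/d) D_A σ` of a density `σ` of weight `1`. -/
def scaleTractor (G : Coord d → Matrix (Fin d) (Fin d) ℝ) (s : Coord d → ℝ) (x : Coord d) :
    TIdx d → ℂ :=
  fun A => (1 / (d : ℂ)) * thomasD (k := 0) G 1 (fun y _ => (s y : ℂ)) x A Fin.elim0

/-- `I² = I^A I_A`. -/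
def scaleSq (G : Coord d → Matrix (Fin d) (Fin d) ℝ) (s : Coord d → ℝ) (x : Coord d) : ℂ :=
  ∑ A, ∑ B, (tractorMetric (G x) A B : ℂ) * scaleTractor G s x A * scaleTractor G s x B

/-- The degenerate Laplacian `I·D = I^A D_A` on tractor tensors of weight `w`. -/
def IdotD (G : Coord d → Matrix (Fin d) (Fin d) ℝ) (s : Coord d → ℝ) (w : ℂ) (f : TField d k) :
    TField d k :=
  fun x => ∑ A, ∑ B, ((tractorMetric (G x) A B : ℂ) * scaleTractor G s x A) • thomasD G w f x B

/-- The operator `(1/I²) I·D` on weight `w`. -/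
def normIdotD (G : Coord d → Matrix (Fin d) (Fin d) ℝ) (s : Coord d → ℝ) (w : ℂ)
    (f : TField d k) : TField d k :=
  fun x => (1 / scaleSq G s x) • IdotD G s w f x

/-- The `𝔰𝔩(2)` generator `y = -(1/I²) I·D` on weight `w`. -/
def yOp (G : Coord d → Matrix (Fin d) (Fin d) ℝ) (s : Coord d → ℝ) (w : ℂ)
    (f : TField d k) : TField d k :=
  fun x => -(1 / scaleSq G s x) • IdotD G s w f x

/-- The `m`-th power, starting on weight `w`, of an operator that lowers the weight by one. -/
def wpow (P : ℂ → TField d k → TField d k) (w : ℂ) : ℕ → TField d k → TField d k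
  | 0, f => f
  | m + 1, f => P (w - m) (wpow P w m f)

/-- The terms of order at most `ℓ` of the normal ordered series
`:K(z): f₀ = ∑ α_m x^m y^m f₀`, where `x = σ` and `K = ∑ α_m z^m`. -/
def normalOrdered (G : Coord d → Matrix (Fin d) (Fin d) ℝ) (s : Coord d → ℝ) (w : ℂ)
    (K : PowerSeries ℂ) (ℓ : ℕ) (f : TField d k) : TField d k :=
  fun x => ∑ m ∈ Finset.range (ℓ + 1),
    (PowerSeries.coeff m K * (s x : ℂ) ^ m) • wpow (yOp G s) w m f x

/-! ### Conformal manifolds, scales and weighted tractor bundles -/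

variable {M : Type*} [TopologicalSpace M] [ChartedSpace (Coord d) M]

/-- The components of a field of bilinear forms in the coordinates of a chart. -/
def gram (g : ∀ p : M, LinearMap.BilinForm ℝ (TangentSpace (𝓡 d) p))
    (φ : OpenPartialHomeomorph M (Coord d)) (x : Coord d) : Matrix (Fin d) (Fin d) ℝ :=
  Matrix.of fun i j => g (φ.symm x)
    (mfderiv (𝓡 d) (𝓡 d) φ.symm x (EuclideanSpace.single i (1 : ℝ) : Coord d))
    (mfderiv (𝓡 d) (𝓡 d) φ.symm x (EuclideanSpace.single j (1 : ℝ) : Coord d))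

variable (d M) in
/-- A smooth pseudo-Riemannian metric. -/
structure PseudoMetric where
  form : ∀ p : M, LinearMap.BilinForm ℝ (TangentSpace (𝓡 d) p)
  symm : ∀ p v w, form p v w = form p w v
  nondegenerate : ∀ p v, (∀ w, form p v w = 0) → v = 0
  smooth : ∀ φ ∈ IsManifold.maximalAtlas (𝓡 d) ∞ M, ∀ i j,
    ContDiffOn ℝ ∞ (fun x => gram form φ x i j) φ.target

/-- `g' = e^{2Υ} g` with `Υ` smooth. -/
structure ConformallyRelated (g g' : PseudoMetric d M) (Υ : M → ℝ) : Prop where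
  smooth : ContMDiff (𝓡 d) 𝓘(ℝ, ℝ) ∞ Υ
  eq : ∀ p v w, g'.form p v w = Real.exp (2 * Υ p) * g.form p v w

variable (d M) in
/-- A conformal structure: a conformal equivalence class of metrics. -/
structure ConformalStructure where
  metrics : Set (PseudoMetric d M)
  nonempty : metrics.Nonempty
  mem_iff : ∀ g ∈ metrics, ∀ g', g' ∈ metrics ↔ ∃ Υ, ConformallyRelated g g' Υ

/-- A smooth real section of `𝓔[1]`, through its representatives in the trivialisations given by
the metrics `g` of the conformal class. -/
structure RealScale (C : ConformalStructure d M) where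
  val : PseudoMetric d M → M → ℝ
  smooth : ∀ g ∈ C.metrics, ContMDiff (𝓡 d) 𝓘(ℝ, ℝ) ∞ (val g)
  conformal : ∀ g ∈ C.metrics, ∀ g' ∈ C.metrics, ∀ Υ, ConformallyRelated g g' Υ →
    ∀ p, val g' p = Real.exp (Υ p) * val g p

/-- A scale in the coordinates of a chart. -/
def RealScale.inChart {C : ConformalStructure d M} (σ : RealScale C) (g : PseudoMetric d M)
    (φ : OpenPartialHomeomorph M (Coord d)) : Coord d → ℝ :=
  fun x => σ.val g (φ.symm x)

/-- The change of the components `(σ, μ_a, ρ)` of a standard tractor at `p` from the chart `φ` and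
the metric `g` to the chart `ψ` and the metric `e^{2Υ} g`.  Invariantly, `(σ, μ, ρ)` becomes
`(σ, μ_b + σ Υ_b, ρ - g^{cd} Υ_c μ_d - ½ σ g^{cd} Υ_c Υ_d)`, and the slots, of weight `1, 1, -1`,
are moreover multiplied by `e^Υ, e^Υ, e^{-Υ}`; the middle slot is a one-form. -/
def tractorTransition (g : PseudoMetric d M) (Υ : M → ℝ) (φ ψ : OpenPartialHomeomorph M (Coord d))
    (p : M) : Matrix (TIdx d) (TIdx d) ℝ :=
  let jac : Fin d → Fin d → ℝ := fun b a => pd b (fun y => φ (ψ.symm y)) (ψ p) a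
  let dΥ : Fin d → ℝ := fun a => pd a (fun y => Υ (φ.symm y)) (φ p)
  let ginv : Matrix (Fin d) (Fin d) ℝ := (gram g.form φ (φ p))⁻¹
  fun A B => match A, B with
  | .inl _, .inl _ => Real.exp (Υ p)
  | .inr (.inl b), .inl _ => Real.exp (Υ p) * ∑ a, jac b a * dΥ a
  | .inr (.inl b), .inr (.inl a) => Real.exp (Υ p) * jac b a
  | .inr (.inr _), .inl _ => -Real.exp (-Υ p) * ((1 / 2) * ∑ a, ∑ c, ginv a c * dΥ a * dΥ c)
  | .inr (.inr _), .inr (.inl a) => -Real.exp (-Υ p) * ∑ c, ginv c a * dΥ c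
  | .inr (.inr _), .inr (.inr _) => Real.exp (-Υ p)
  | _, _ => 0

variable (d k) in
/-- A tensor part of the `k`-th tensor power of a space with a nondegenerate symmetric form `h`:
a subspace assigned naturally to `h`, that is, compatibly with all linear isomorphisms.
Equivalently, a subrepresentation, for the orthogonal group of `h`, of the `k`-th tensor power. -/
structure TensorPart where
  space : Matrix (TIdx d) (TIdx d) ℝ → Submodule ℂ (TTensor d k)
  natural : ∀ h : Matrix (TIdx d) (TIdx d) ℝ, h.IsSymm → IsUnit h.det →
    ∀ S : Matrix (TIdx d) (TIdx d) ℝ, IsUnit S.det →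
    ∀ T : TTensor d k, T ∈ space (Sᵀ * h * S) ↔ tensorPowerAct S T ∈ space h

/-- A smooth section of the weighted tractor bundle `𝓔^Φ[w]`, where `𝓔^Φ` is the tensor part `Φ` of
the `k`-th tensor power of the standard tractor bundle: components for every metric of the conformal
class and every chart, related by the change of components of tractors and the factor `e^{wΥ}`. -/
structure TractorSection (C : ConformalStructure d M) (Φ : TensorPart d k) (w : ℂ) where
  comp : PseudoMetric d M → OpenPartialHomeomorph M (Coord d) → TField d k
  smooth : ∀ g ∈ C.metrics, ∀ φ ∈ IsManifold.maximalAtlas (𝓡 d) ∞ M,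
    ContDiffOn ℝ ∞ (comp g φ) φ.target
  mem : ∀ g ∈ C.metrics, ∀ φ ∈ IsManifold.maximalAtlas (𝓡 d) ∞ M, ∀ x ∈ φ.target,
    comp g φ x ∈ Φ.space (tractorMetric (gram g.form φ x))
  transform : ∀ g ∈ C.metrics, ∀ g' ∈ C.metrics, ∀ Υ, ConformallyRelated g g' Υ →
    ∀ φ ∈ IsManifold.maximalAtlas (𝓡 d) ∞ M, ∀ ψ ∈ IsManifold.maximalAtlas (𝓡 d) ∞ M,
    ∀ p ∈ φ.source ∩ ψ.source,
      comp g' ψ (ψ p) = Complex.exp (w * Υ p) •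
        tensorPowerAct (tractorTransition g Υ φ ψ p) (comp g φ (φ p))

/-- `I²` is nowhere zero. -/
def ScaleSqNowhereZero {C : ConformalStructure d M} (σ : RealScale C) : Prop :=
  ∀ g ∈ C.metrics, ∀ φ ∈ IsManifold.maximalAtlas (𝓡 d) ∞ M, ∀ x ∈ φ.target,
    scaleSq (gram g.form φ) (σ.inChart g φ) x ≠ 0

/-- The section `u` does not vanish identically along the zero locus of `σ`. -/
def TractorSection.NonzeroAlong {C : ConformalStructure d M} {Φ : TensorPart d k} {w : ℂ}
    (u : TractorSection C Φ w) (σ : RealScale C) : Prop :=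
  ∃ g ∈ C.metrics, ∃ φ ∈ IsManifold.maximalAtlas (𝓡 d) ∞ M, ∃ p ∈ φ.source,
    σ.val g p = 0 ∧ u.comp g φ (φ p) ≠ 0

/-- `:K(z): f₀` solves `I·D f = 0` formally: for every `ℓ`, its terms of order at most `ℓ`
solve `I·D f = O(σ^ℓ)`. -/
def IsFormalSolution {C : ConformalStructure d M} (σ : RealScale C) {Φ : TensorPart d k} {w : ℂ}
    (K : PowerSeries ℂ) (f₀ : TractorSection C Φ w) : Prop :=
  ∀ ℓ : ℕ, ∀ g ∈ C.metrics, ∀ φ ∈ IsManifold.maximalAtlas (𝓡 d) ∞ M,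
    ∃ r : TField d k, ContDiffOn ℝ ∞ r φ.target ∧ ∀ x ∈ φ.target,
      IdotD (gram g.form φ) (σ.inChart g φ) w
          (normalOrdered (gram g.form φ) (σ.inChart g φ) w K ℓ (f₀.comp g φ)) x
        = ((σ.inChart g φ x : ℂ) ^ ℓ) • r x

/-- `:K:` is a formal solution operator on `𝓔^Φ[w]`: `K = 1 + α₁ z + α₂ z² + ⋯`, and `:K(z): f₀`
formally solves `I·D f = 0` for every section `f₀`. -/
def IsFormalSolutionOperator {C : ConformalStructure d M} (σ : RealScale C) (Φ : TensorPart d k)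
    (w : ℂ) (K : PowerSeries ℂ) : Prop :=
  PowerSeries.constantCoeff K = 1 ∧ ∀ f₀ : TractorSection C Φ w, IsFormalSolution σ K f₀

/-! ### The Bessel series -/

/-- The Pochhammer symbol `(a)_m = a (a-1) ⋯ (a-m+1)`. -/
def pochhammer (a : ℂ) (m : ℕ) : ℂ := ∏ j ∈ Finset.range m, (a - j)

/-- The Bessel function of the first kind, with principal branch of `u ^ ν`. -/
def besselJ (ν u : ℂ) : ℂ :=
  (u / 2) ^ ν * ∑' m : ℕ, (-1) ^ m / ((m.factorial : ℂ) * Complex.Gamma (m + ν + 1)) *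
    (u / 2) ^ (2 * m)

end DegenerateLaplacian

end

/-!
In a chart and a metric, `[I·D, σ] = I² (d + 2w)` on weight `w`, and hence
`[I·D, σ^{n+1}] = (n+1) (d + 2w + n) I² σ^n`. Together with `I·D = -I² y` this makes `I·D` of a
truncated normal ordered series telescope:
`I·D ∑_{m≤ℓ} α_m σ^m y^m f = α_ℓ σ^ℓ I·D y^ℓ f
  + I² ∑_{m<ℓ} σ^m ((m+1) (h₀-m-2) α_{m+1} - α_m) y^{m+1} f`.
So the recursion `(m+1) (h₀-m-2) α_{m+1} = α_m`, which `α_m = (-1)^m / (m! (m+1-h₀)_m)` solves,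
suffices. It is also necessary: by the same commutators `y^{m+1} (σ^{m+1} u)` is a nonzero multiple
of `u` along `Σ`, and `σ` does not vanish on any open set because `I² ≠ 0`, so that powers of `σ`
can be cancelled.
-/

noncomputable section

namespace DegenerateLaplacian

open Filter Topology

section PartialDerivatives

variable {d : ℕ} {V : Type*} [NormedAddCommGroup V] [NormedSpace ℝ V] {f g : Coord d → V}
  {x : Coord d}

theorem pd_add (hf : DifferentiableAt ℝ f x) (hg : DifferentiableAt ℝ g x) (a : Fin d) :
    pd a (fun y => f y + g y) x = pd a f x + pd a g x := by
  simp only [pd, fderiv_fun_add hf hg, add_apply]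

theorem pd_congr (h : f =ᶠ[𝓝 x] g) (a : Fin d) : pd a f x = pd a g x := by
  simp only [pd, h.fderiv_eq]

theorem contDiffOn_pd {U : Set (Coord d)} (hU : IsOpen U) (hf : ContDiffOn ℝ ∞ f U) (a : Fin d) :
    ContDiffOn ℝ ∞ (pd a f) U :=
  (hf.fderiv_of_isOpen hU (by simp)).clm_apply contDiffOn_const

theorem differentiableAt_pd (hf : ContDiffAt ℝ 2 f x) (a : Fin d) :
    DifferentiableAt ℝ (pd a f) x :=
  ((hf.fderiv_right (m := 1) (by norm_num)).differentiableAt (by norm_num)).clm_apply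
    (differentiableAt_const _)

theorem eventually_differentiableAt (hf : ContDiffAt ℝ 2 f x) :
    ∀ᶠ y in 𝓝 x, DifferentiableAt ℝ f y :=
  (hf.eventually (by norm_num)).mono fun _ hy => hy.differentiableAt (by norm_num)

theorem pd_rank_zero (φ : Coord d → ℂ) (a : Fin d) (x : Coord d) :
    pd a (fun y (_ : Fin 0 → TIdx d) => φ y) x = fun _ => pd a φ x := by
  have h : fderiv ℝ (fun y (_ : Fin 0 → TIdx d) => φ y) x =
      ((ContinuousLinearEquiv.funUnique (Fin 0 → TIdx d) ℝ ℂ).symm :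
        ℂ →L[ℝ] (Fin 0 → TIdx d) → ℂ).comp (fderiv ℝ φ x) :=
    (ContinuousLinearEquiv.funUnique (Fin 0 → TIdx d) ℝ ℂ).symm.comp_fderiv
  rw [pd, h]
  rfl

variable [NormedSpace ℂ V] [IsScalarTower ℝ ℂ V]

theorem pd_smul {φ : Coord d → ℂ} (hφ : DifferentiableAt ℝ φ x) (hf : DifferentiableAt ℝ f x)
    (a : Fin d) : pd a (fun y => φ y • f y) x = pd a φ x • f x + φ x • pd a f x := by
  simp only [pd, fderiv_fun_smul hφ hf, add_apply,
    smul_apply, ContinuousLinearMap.smulRight_apply, add_comm]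

theorem pd_const_smul (c : ℂ) (f : Coord d → V) (a : Fin d) (x : Coord d) :
    pd a (fun y => c • f y) x = c • pd a f x := by
  have h : fderiv ℝ (fun y => c • f y) x = c • fderiv ℝ f x :=
    congrFun (fderiv_const_smul_field c) x
  rw [pd, h, smul_apply, pd]

end PartialDerivatives

section CovariantDerivative

variable {d k : ℕ} {G : Coord d → Matrix (Fin d) (Fin d) ℝ} {φ ψ : Coord d → ℂ} {f g : TField d k}
  {x : Coord d}

theorem derivationAct_add (A : Matrix (TIdx d) (TIdx d) ℝ) (S T : TTensor d k) :
    derivationAct A (S + T) = derivationAct A S + derivationAct A T := by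
  ext B
  simp only [derivationAct, Pi.add_apply, mul_add, Finset.sum_add_distrib]

theorem derivationAct_smul (A : Matrix (TIdx d) (TIdx d) ℝ) (c : ℂ) (T : TTensor d k) :
    derivationAct A (c • T) = c • derivationAct A T := by
  ext B
  simp only [derivationAct, Pi.smul_apply, smul_eq_mul, Finset.mul_sum, mul_left_comm]

theorem nabla_add (hf : DifferentiableAt ℝ f x) (hg : DifferentiableAt ℝ g x) (a : Fin d) :
    nabla G a (fun y => f y + g y) x = nabla G a f x + nabla G a g x := by
  simp only [nabla, pd_add hf hg, derivationAct_add, add_add_add_comm]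

theorem nabla_smul (hφ : DifferentiableAt ℝ φ x) (hf : DifferentiableAt ℝ f x) (a : Fin d) :
    nabla G a (fun y => φ y • f y) x = pd a φ x • f x + φ x • nabla G a f x := by
  simp only [nabla, pd_smul hφ hf, derivationAct_smul, smul_add, add_assoc]

theorem nabla_const_smul (c : ℂ) (f : TField d k) (a : Fin d) :
    nabla G a (fun y => c • f y) = fun y => c • nabla G a f y := by
  funext y
  simp only [nabla, pd_const_smul, derivationAct_smul, smul_add]

theorem nabla_rank_zero (φ : Coord d → ℂ) (a : Fin d) :
    nabla (k := 0) G a (fun y _ => φ y) = fun y _ => pd a φ y := by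
  funext y B
  simp only [nabla, pd_rank_zero, derivationAct, Pi.add_apply, Finset.univ_eq_empty,
    Finset.sum_empty, add_zero]

theorem nabla_eventuallyEq (h : f =ᶠ[𝓝 x] g) (a : Fin d) : nabla G a f =ᶠ[𝓝 x] nabla G a g := by
  filter_upwards [h.eventuallyEq_nhds] with y hy
  simp only [nabla, hy.eq_of_nhds, pd_congr hy]

theorem nabla_congr (h : f =ᶠ[𝓝 x] g) (a : Fin d) : nabla G a f x = nabla G a g x :=
  (nabla_eventuallyEq h a).eq_of_nhds

theorem differentiableAt_nabla (hA : ∀ a A B, DifferentiableAt ℝ (fun y => tractorConn G y a A B) x)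
    (hf : ContDiffAt ℝ 2 f x) (a : Fin d) : DifferentiableAt ℝ (nabla G a f) x := by
  have df : DifferentiableAt ℝ f x := hf.differentiableAt (by norm_num)
  refine (differentiableAt_pd hf a).add (differentiableAt_pi.2 fun B => ?_)
  exact .fun_sum fun r _ => .fun_sum fun C _ =>
    (Complex.ofRealCLM.differentiableAt.comp x (hA a _ _)).mul (differentiableAt_pi.1 df _)

/-- The second covariant derivative `∇_a ∇_b f`, with the Levi-Civita connection acting on the
index `b`. -/
def hessian (G : Coord d → Matrix (Fin d) (Fin d) ℝ) (a b : Fin d) (f : TField d k) : TField d k :=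
  fun x => nabla G a (nabla G b f) x - ∑ c, ((christoffel G x c a b : ℝ) : ℂ) • nabla G c f x

/-- The second covariant derivative of a function. -/
def scalarHessian (G : Coord d → Matrix (Fin d) (Fin d) ℝ) (a b : Fin d) (φ : Coord d → ℂ)
    (x : Coord d) : ℂ :=
  pd a (pd b φ) x - ∑ c, ((christoffel G x c a b : ℝ) : ℂ) * pd c φ x

theorem hessian_congr (h : f =ᶠ[𝓝 x] g) (a b : Fin d) : hessian G a b f x = hessian G a b g x := by
  simp only [hessian, nabla_congr h, nabla_congr (nabla_eventuallyEq h b)]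

theorem hessian_add (hA : ∀ a A B, DifferentiableAt ℝ (fun y => tractorConn G y a A B) x)
    (hf : ContDiffAt ℝ 2 f x) (hg : ContDiffAt ℝ 2 g x) (a b : Fin d) :
    hessian G a b (fun y => f y + g y) x = hessian G a b f x + hessian G a b g x := by
  have inner : nabla G b (fun y => f y + g y) =ᶠ[𝓝 x] fun y => nabla G b f y + nabla G b g y := by
    filter_upwards [eventually_differentiableAt hf, eventually_differentiableAt hg] with y hfy hgy
    exact nabla_add hfy hgy b
  simp only [hessian, nabla_congr inner, nabla_add (differentiableAt_nabla hA hf b)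
    (differentiableAt_nabla hA hg b), nabla_add (hf.differentiableAt (by norm_num))
    (hg.differentiableAt (by norm_num)), smul_add, Finset.sum_add_distrib, add_sub_add_comm]

theorem hessian_const_smul (c : ℂ) (f : TField d k) (a b : Fin d) :
    hessian G a b (fun y => c • f y) x = c • hessian G a b f x := by
  simp only [hessian, nabla_const_smul, smul_sub, Finset.smul_sum, smul_comm c]

theorem hessian_rank_zero (φ : Coord d → ℂ) (a b : Fin d) :
    hessian (k := 0) G a b (fun y _ => φ y) x = fun _ => scalarHessian G a b φ x := by
  funext B
  simp only [hessian, scalarHessian, nabla_rank_zero, Pi.sub_apply, Finset.sum_apply, Pi.smul_apply,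
    smul_eq_mul]

theorem hessian_smul (hA : ∀ a A B, DifferentiableAt ℝ (fun y => tractorConn G y a A B) x)
    (hφ : ContDiffAt ℝ 2 φ x) (hf : ContDiffAt ℝ 2 f x) (a b : Fin d) :
    hessian G a b (fun y => φ y • f y) x = scalarHessian G a b φ x • f x
      + (pd a φ x • nabla G b f x + pd b φ x • nabla G a f x) + φ x • hessian G a b f x := by
  have dφ : DifferentiableAt ℝ φ x := hφ.differentiableAt (by norm_num)
  have df : DifferentiableAt ℝ f x := hf.differentiableAt (by norm_num)
  have dnf := differentiableAt_nabla hA hf b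
  have inner : nabla G b (fun y => φ y • f y) =ᶠ[𝓝 x]
      fun y => pd b φ y • f y + φ y • nabla G b f y := by
    filter_upwards [eventually_differentiableAt hφ, eventually_differentiableAt hf] with y hφy hfy
    exact nabla_smul hφy hfy b
  have second : nabla G a (nabla G b fun y => φ y • f y) x =
      (pd a (pd b φ) x • f x + pd b φ x • nabla G a f x)
        + (pd a φ x • nabla G b f x + φ x • nabla G a (nabla G b f) x) := by
    rw [nabla_congr inner, nabla_add ((differentiableAt_pd hφ b).fun_smul df) (dφ.fun_smul dnf),
      nabla_smul (differentiableAt_pd hφ b) df, nabla_smul dφ dnf]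
  simp only [hessian, scalarHessian, second, nabla_smul dφ df, smul_add, smul_sub, sub_smul,
    Finset.sum_add_distrib, Finset.sum_smul, Finset.smul_sum, mul_smul, smul_comm (φ x)]
  abel

/-- The Laplacian of functions. -/
def scalarLaplacian (G : Coord d → Matrix (Fin d) (Fin d) ℝ) (φ : Coord d → ℂ) (x : Coord d) : ℂ :=
  ∑ a, ∑ b, (((G x)⁻¹ a b : ℝ) : ℂ) * scalarHessian G a b φ x

/-- The inner product `g^{ab} (∂_a φ) (∂_b ψ)` of the gradients of two functions. -/
def gradInner (G : Coord d → Matrix (Fin d) (Fin d) ℝ) (φ ψ : Coord d → ℂ) (x : Coord d) : ℂ :=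
  ∑ a, ∑ b, (((G x)⁻¹ a b : ℝ) : ℂ) * pd a φ x * pd b ψ x

/-- The derivative `g^{ab} (∂_a φ) ∇_b f` of a tractor field along the gradient of a function. -/
def gradPairing (G : Coord d → Matrix (Fin d) (Fin d) ℝ) (φ : Coord d → ℂ) (f : TField d k) :
    TField d k :=
  fun x => ∑ a, ∑ b, ((((G x)⁻¹ a b : ℝ) : ℂ) * pd a φ x) • nabla G b f x

theorem laplacian_eq_sum_hessian (f : TField d k) (x : Coord d) :
    laplacian G f x = ∑ a, ∑ b, (((G x)⁻¹ a b : ℝ) : ℂ) • hessian G a b f x :=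
  rfl

theorem laplacian_congr (h : f =ᶠ[𝓝 x] g) : laplacian G f x = laplacian G g x := by
  simp only [laplacian_eq_sum_hessian, hessian_congr h]

theorem laplacian_add (hA : ∀ a A B, DifferentiableAt ℝ (fun y => tractorConn G y a A B) x)
    (hf : ContDiffAt ℝ 2 f x) (hg : ContDiffAt ℝ 2 g x) :
    laplacian G (fun y => f y + g y) x = laplacian G f x + laplacian G g x := by
  simp only [laplacian_eq_sum_hessian, hessian_add hA hf hg, smul_add, Finset.sum_add_distrib]

theorem laplacian_const_smul (c : ℂ) (f : TField d k) :
    laplacian G (fun y => c • f y) x = c • laplacian G f x := by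
  simp only [laplacian_eq_sum_hessian, hessian_const_smul, Finset.smul_sum, smul_comm c]

theorem laplacian_rank_zero (φ : Coord d → ℂ) :
    laplacian (k := 0) G (fun y _ => φ y) x = fun _ => scalarLaplacian G φ x := by
  funext B
  simp only [laplacian_eq_sum_hessian, scalarLaplacian, hessian_rank_zero, Finset.sum_apply,
    Pi.smul_apply, smul_eq_mul]

theorem gradPairing_eq_sum_swap (hG : (G x).IsSymm) :
    gradPairing G φ f x = ∑ a, ∑ b, ((((G x)⁻¹ a b : ℝ) : ℂ) * pd b φ x) • nabla G a f x := by
  have symm_inv : ((G x)⁻¹).IsSymm := by rw [Matrix.IsSymm, Matrix.transpose_nonsing_inv, hG.eq]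
  rw [gradPairing, Finset.sum_comm]
  simp only [symm_inv.apply]

theorem laplacian_smul (hA : ∀ a A B, DifferentiableAt ℝ (fun y => tractorConn G y a A B) x)
    (hG : (G x).IsSymm) (hφ : ContDiffAt ℝ 2 φ x) (hf : ContDiffAt ℝ 2 f x) :
    laplacian G (fun y => φ y • f y) x = scalarLaplacian G φ x • f x
      + (2 : ℂ) • gradPairing G φ f x + φ x • laplacian G f x := by
  rw [two_smul]
  nth_rewrite 2 [gradPairing_eq_sum_swap hG]
  simp only [laplacian_eq_sum_hessian, hessian_smul hA hφ hf, scalarLaplacian, gradPairing,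
    smul_add, Finset.sum_add_distrib, Finset.sum_smul, Finset.smul_sum, smul_smul,
    mul_comm (φ x)]

theorem gradPairing_smul (hψ : DifferentiableAt ℝ ψ x) (hf : DifferentiableAt ℝ f x) :
    gradPairing G φ (fun y => ψ y • f y) x =
      gradInner G φ ψ x • f x + ψ x • gradPairing G φ f x := by
  simp only [gradPairing, gradInner, nabla_smul hψ hf, smul_add, Finset.sum_add_distrib,
    Finset.sum_smul, Finset.smul_sum, smul_smul, mul_comm (ψ x)]

end CovariantDerivative

section ScaleTractor

variable {d k : ℕ} {G : Coord d → Matrix (Fin d) (Fin d) ℝ} {s : Coord d → ℝ} {w : ℂ}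
  {f g : TField d k} {x : Coord d}

/-- The bottom slot of the scale tractor. -/
def scaleBottom (G : Coord d → Matrix (Fin d) (Fin d) ℝ) (s : Coord d → ℝ) (x : Coord d) : ℂ :=
  -(1 / (d : ℂ)) * (scalarLaplacian G (fun y => (s y : ℂ)) x + schoutenTrace G x * s x)

theorem thomasD_congr (h : f =ᶠ[𝓝 x] g) : thomasD G w f x = thomasD G w g x := by
  funext A
  rcases A with _ | _ | _ <;>
    simp only [thomasD, h.eq_of_nhds, nabla_congr h, laplacian_congr h]

theorem thomasD_add (hA : ∀ a A B, DifferentiableAt ℝ (fun y => tractorConn G y a A B) x)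
    (hf : ContDiffAt ℝ 2 f x) (hg : ContDiffAt ℝ 2 g x) :
    thomasD G w (fun y => f y + g y) x = thomasD G w f x + thomasD G w g x := by
  funext A
  rcases A with _ | _ | _ <;>
    simp only [thomasD, Pi.add_apply, laplacian_add hA hf hg,
      nabla_add (hf.differentiableAt (by norm_num)) (hg.differentiableAt (by norm_num))] <;>
    module

theorem thomasD_const_smul (c : ℂ) (f : TField d k) :
    thomasD G w (fun y => c • f y) x = c • thomasD G w f x := by
  funext A
  rcases A with _ | _ | _ <;>
    simp only [thomasD, Pi.smul_apply, laplacian_const_smul, nabla_const_smul] <;> module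

theorem IdotD_congr (h : f =ᶠ[𝓝 x] g) : IdotD G s w f x = IdotD G s w g x := by
  simp only [IdotD, thomasD_congr h]

theorem IdotD_add (hA : ∀ a A B, DifferentiableAt ℝ (fun y => tractorConn G y a A B) x)
    (hf : ContDiffAt ℝ 2 f x) (hg : ContDiffAt ℝ 2 g x) :
    IdotD G s w (fun y => f y + g y) x = IdotD G s w f x + IdotD G s w g x := by
  simp only [IdotD, thomasD_add hA hf hg, Pi.add_apply, smul_add, Finset.sum_add_distrib]

theorem IdotD_const_smul (c : ℂ) (f : TField d k) :
    IdotD G s w (fun y => c • f y) x = c • IdotD G s w f x := by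
  simp only [IdotD, thomasD_const_smul, Pi.smul_apply, Finset.smul_sum, smul_comm c]

theorem scaleTractor_bottom (x : Coord d) (u : Unit) :
    scaleTractor G s x (.inr (.inr u)) = scaleBottom G s x := by
  simp only [scaleTractor, thomasD, laplacian_rank_zero, Pi.neg_apply, Pi.add_apply, Pi.smul_apply,
    smul_eq_mul, scaleBottom]
  ring

theorem scaleSq_eq_zero_of_eventuallyEq_zero (h : s =ᶠ[𝓝 x] 0) : scaleSq G s x = 0 := by
  have scale_zero : (fun y (_ : Fin 0 → TIdx d) => (s y : ℂ)) =ᶠ[𝓝 x] fun _ => (0 : ℂ) • 0 := by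
    filter_upwards [h] with y hy
    simp only [hy, Pi.zero_apply, Complex.ofReal_zero, zero_smul]
    rfl
  have thomasD_zero : thomasD G 1 (fun y (_ : Fin 0 → TIdx d) => (s y : ℂ)) x = 0 := by
    rw [thomasD_congr scale_zero, thomasD_const_smul, zero_smul]
  have tractor_zero : scaleTractor G s x = 0 := by
    funext A
    simp only [scaleTractor, thomasD_zero, Pi.zero_apply, mul_zero]
  simp only [scaleSq, tractor_zero, Pi.zero_apply, mul_zero, Finset.sum_const_zero]

theorem frequently_scale_ne_zero (h : scaleSq G s x ≠ 0) : ∃ᶠ y in 𝓝 x, s y ≠ 0 := fun hs =>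
  h (scaleSq_eq_zero_of_eventuallyEq_zero (hs.mono fun _ => not_not.1))

variable [NeZero d]

theorem scaleTractor_top (x : Coord d) (u : Unit) : scaleTractor G s x (.inl u) = s x := by
  have hd : (d : ℂ) ≠ 0 := NeZero.ne _
  simp only [scaleTractor, thomasD, Pi.smul_apply, smul_eq_mul]
  field_simp
  ring

theorem scaleTractor_middle (x : Coord d) (a : Fin d) :
    scaleTractor G s x (.inr (.inl a)) = pd a (fun y => (s y : ℂ)) x := by
  have hd : (d : ℂ) ≠ 0 := NeZero.ne _
  simp only [scaleTractor, thomasD, nabla_rank_zero, Pi.smul_apply, smul_eq_mul]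
  field_simp
  ring

theorem scaleSq_eq (x : Coord d) :
    scaleSq G s x = 2 * s x * scaleBottom G s x
      + gradInner G (fun y => (s y : ℂ)) (fun y => (s y : ℂ)) x := by
  simp only [scaleSq, tractorMetric, Fintype.sum_sum_type, scaleTractor_top, scaleTractor_middle,
    scaleTractor_bottom, gradInner, Finset.univ_unique, Finset.sum_singleton, Complex.ofReal_zero,
    Complex.ofReal_one, zero_mul, one_mul, Finset.sum_const_zero, zero_add, add_zero]
  ring

theorem IdotD_eq (f : TField d k) (x : Coord d) :
    IdotD G s w f x = -((s x : ℂ) • (laplacian G f x + ((schoutenTrace G x : ℂ) * w) • f x))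
      + (d + 2 * w - 2) • gradPairing G (fun y => (s y : ℂ)) f x
      + (scaleBottom G s x * ((d + 2 * w - 2) * w)) • f x := by
  have gradient : ∑ a, ∑ b, ((((G x)⁻¹ a b : ℝ) : ℂ) * pd a (fun y => (s y : ℂ)) x) •
      (d + 2 * w - 2) • nabla G b f x =
        (d + 2 * w - 2) • gradPairing G (fun y => (s y : ℂ)) f x := by
    simp only [gradPairing, Finset.smul_sum, smul_comm (d + 2 * w - 2)]
  simp only [IdotD, tractorMetric, Fintype.sum_sum_type, scaleTractor_top, scaleTractor_middle,
    scaleTractor_bottom, thomasD, Finset.univ_unique, Finset.sum_singleton, Complex.ofReal_zero,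
    Complex.ofReal_one, zero_mul, one_mul, zero_smul, Finset.sum_const_zero, zero_add, add_zero,
    gradient]
  module

theorem IdotD_scale_smul (hA : ∀ a A B, DifferentiableAt ℝ (fun y => tractorConn G y a A B) x)
    (hG : (G x).IsSymm) (hs : ContDiffAt ℝ 2 s x) (hf : ContDiffAt ℝ 2 f x) :
    IdotD G s (w + 1) (fun y => (s y : ℂ) • f y) x =
      (s x : ℂ) • IdotD G s w f x + ((d + 2 * w) * scaleSq G s x) • f x := by
  have hd : (d : ℂ) ≠ 0 := NeZero.ne _
  have hs' : ContDiffAt ℝ 2 (fun y => (s y : ℂ)) x :=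
    Complex.ofRealCLM.contDiff.contDiffAt.comp x hs
  have laplacian_scale : scalarLaplacian G (fun y => (s y : ℂ)) x =
      -(d * scaleBottom G s x) - schoutenTrace G x * s x := by
    rw [scaleBottom]; field_simp; ring
  rw [IdotD_eq, IdotD_eq, scaleSq_eq, laplacian_smul hA hG hs' hf,
    gradPairing_smul (hs'.differentiableAt (by norm_num)) (hf.differentiableAt (by norm_num)),
    laplacian_scale]
  module

end ScaleTractor

section MatrixSmoothness

variable {E ι : Type*} [NormedAddCommGroup E] [NormedSpace ℝ E] [Fintype ι] [DecidableEq ι]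
  {A : E → Matrix ι ι ℝ} {U : Set E} {n : WithTop ℕ∞}

theorem contDiffOn_det (hA : ∀ i j, ContDiffOn ℝ n (fun x => A x i j) U) :
    ContDiffOn ℝ n (fun x => (A x).det) U := by
  simp only [Matrix.det_apply']
  exact ContDiffOn.sum fun σ _ => contDiffOn_const.mul (contDiffOn_prod fun i _ => hA _ _)

theorem contDiffOn_inv_apply (hA : ∀ i j, ContDiffOn ℝ n (fun x => A x i j) U)
    (hdet : ∀ x ∈ U, (A x).det ≠ 0) (i j : ι) : ContDiffOn ℝ n (fun x => (A x)⁻¹ i j) U := by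
  simp only [Matrix.inv_def, Ring.inverse_eq_inv', Matrix.smul_apply, Matrix.adjugate_apply,
    smul_eq_mul]
  refine ((contDiffOn_det hA).inv hdet).mul (contDiffOn_det fun k l => ?_)
  rcases eq_or_ne k j with rfl | hk
  · simpa only [Matrix.updateRow_self] using contDiffOn_const
  · simpa only [Matrix.updateRow_ne hk] using hA k l

theorem contDiffOn_ofReal {s : E → ℝ} (hs : ContDiffOn ℝ n s U) :
    ContDiffOn ℝ n (fun y => (s y : ℂ)) U :=
  Complex.ofRealCLM.contDiff.comp_contDiffOn hs

end MatrixSmoothness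

section Smoothness

variable {d k : ℕ} {G : Coord d → Matrix (Fin d) (Fin d) ℝ} {s : Coord d → ℝ} {w : ℂ}
  {U : Set (Coord d)} {f : TField d k}

/-- `G` is the matrix of components of a smooth pseudo-Riemannian metric on the open set `U`. -/
structure IsMetricOn (G : Coord d → Matrix (Fin d) (Fin d) ℝ) (U : Set (Coord d)) : Prop where
  isOpen : IsOpen U
  contDiffOn_apply : ∀ i j, ContDiffOn ℝ ∞ (fun x => G x i j) U
  isSymm : ∀ x ∈ U, (G x).IsSymm
  det_ne_zero : ∀ x ∈ U, (G x).det ≠ 0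

namespace IsMetricOn

theorem contDiffAt {V : Type*} [NormedAddCommGroup V] [NormedSpace ℝ V] {F : Coord d → V}
    (hG : IsMetricOn G U) (hF : ContDiffOn ℝ ∞ F U) {x : Coord d} (hx : x ∈ U) :
    ContDiffAt ℝ 2 F x :=
  (hF.contDiffAt (hG.isOpen.mem_nhds hx)).of_le (WithTop.coe_le_coe.2 le_top)

theorem contDiffOn_inv (hG : IsMetricOn G U) (a b : Fin d) :
    ContDiffOn ℝ ∞ (fun x => (G x)⁻¹ a b) U :=
  contDiffOn_inv_apply hG.contDiffOn_apply hG.det_ne_zero a b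

theorem contDiffOn_christoffel (hG : IsMetricOn G U) (c a b : Fin d) :
    ContDiffOn ℝ ∞ (fun x => christoffel G x c a b) U :=
  contDiffOn_const.mul (.sum fun e _ => (hG.contDiffOn_inv c e).mul
    (((contDiffOn_pd hG.isOpen (hG.contDiffOn_apply b e) a).add
      (contDiffOn_pd hG.isOpen (hG.contDiffOn_apply a e) b)).sub
        (contDiffOn_pd hG.isOpen (hG.contDiffOn_apply a b) e)))

theorem contDiffOn_riemann (hG : IsMetricOn G U) (a b c e : Fin d) :
    ContDiffOn ℝ ∞ (fun x => riemann G x a b c e) U :=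
  ((contDiffOn_pd hG.isOpen (hG.contDiffOn_christoffel c b e) a).sub
    (contDiffOn_pd hG.isOpen (hG.contDiffOn_christoffel c a e) b)).add
      (.sum fun m _ =>
        ((hG.contDiffOn_christoffel c a m).mul (hG.contDiffOn_christoffel m b e)).sub
          ((hG.contDiffOn_christoffel c b m).mul (hG.contDiffOn_christoffel m a e)))

theorem contDiffOn_ricci (hG : IsMetricOn G U) (a b : Fin d) :
    ContDiffOn ℝ ∞ (fun x => ricci G x a b) U :=
  .sum fun c _ => hG.contDiffOn_riemann c a c b

theorem contDiffOn_schoutenTrace (hG : IsMetricOn G U) : ContDiffOn ℝ ∞ (schoutenTrace G) U :=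
  (ContDiffOn.sum fun a _ => .sum fun b _ =>
    (hG.contDiffOn_inv a b).mul (hG.contDiffOn_ricci a b)).div_const _

theorem contDiffOn_schouten (hG : IsMetricOn G U) (a b : Fin d) :
    ContDiffOn ℝ ∞ (fun x => schouten G x a b) U :=
  ((hG.contDiffOn_ricci a b).sub
    (hG.contDiffOn_schoutenTrace.mul (hG.contDiffOn_apply a b))).div_const _

theorem contDiffOn_tractorConn (hG : IsMetricOn G U) (a : Fin d) (A B : TIdx d) :
    ContDiffOn ℝ ∞ (fun x => tractorConn G x a A B) U := by
  rcases A with _ | b | _ <;> rcases B with _ | c | _ <;> simp only [tractorConn]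
  all_goals first
    | exact contDiffOn_const
    | exact hG.contDiffOn_schouten _ _
    | exact (hG.contDiffOn_christoffel _ _ _).neg
    | exact hG.contDiffOn_apply _ _
    | exact (ContDiffOn.sum fun e _ => (hG.contDiffOn_schouten _ _).mul (hG.contDiffOn_inv _ _)).neg

theorem differentiableAt_tractorConn (hG : IsMetricOn G U) {x : Coord d} (hx : x ∈ U) (a : Fin d)
    (A B : TIdx d) : DifferentiableAt ℝ (fun y => tractorConn G y a A B) x :=
  (hG.contDiffAt (hG.contDiffOn_tractorConn a A B) hx).differentiableAt (by norm_num)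

theorem contDiffOn_nabla (hG : IsMetricOn G U) (hf : ContDiffOn ℝ ∞ f U) (a : Fin d) :
    ContDiffOn ℝ ∞ (nabla G a f) U :=
  (contDiffOn_pd hG.isOpen hf a).add (contDiffOn_pi.2 fun _ => .sum fun _ _ => .sum fun _ _ =>
    (contDiffOn_ofReal (hG.contDiffOn_tractorConn a _ _)).mul (contDiffOn_pi.1 hf _))

theorem contDiffOn_laplacian (hG : IsMetricOn G U) (hf : ContDiffOn ℝ ∞ f U) :
    ContDiffOn ℝ ∞ (laplacian G f) U :=
  .sum fun a _ => .sum fun b _ => (contDiffOn_ofReal (hG.contDiffOn_inv a b)).smul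
    ((hG.contDiffOn_nabla (hG.contDiffOn_nabla hf b) a).sub (.sum fun c _ =>
      (contDiffOn_ofReal (hG.contDiffOn_christoffel c a b)).smul (hG.contDiffOn_nabla hf c)))

theorem contDiffOn_thomasD (hG : IsMetricOn G U) (hf : ContDiffOn ℝ ∞ f U) (A : TIdx d) :
    ContDiffOn ℝ ∞ (fun x => thomasD G w f x A) U := by
  rcases A with _ | a | _
  · exact hf.const_smul ((d + 2 * w - 2) * w)
  · exact (hG.contDiffOn_nabla hf a).const_smul (d + 2 * w - 2)
  · exact ((hG.contDiffOn_laplacian hf).add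
      (((contDiffOn_ofReal hG.contDiffOn_schoutenTrace).mul contDiffOn_const).smul hf)).neg

theorem contDiffOn_tractorMetric (hG : IsMetricOn G U) (A B : TIdx d) :
    ContDiffOn ℝ ∞ (fun x => tractorMetric (G x) A B) U := by
  rcases A with _ | b | _ <;> rcases B with _ | c | _ <;> simp only [tractorMetric]
  all_goals first
    | exact contDiffOn_const
    | exact hG.contDiffOn_inv _ _

theorem contDiffOn_scaleTractor (hG : IsMetricOn G U) (hs : ContDiffOn ℝ ∞ s U) (A : TIdx d) :
    ContDiffOn ℝ ∞ (fun x => scaleTractor G s x A) U :=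
  contDiffOn_const.mul (contDiffOn_pi.1
    (hG.contDiffOn_thomasD (contDiffOn_pi.2 fun _ => contDiffOn_ofReal hs) A) _)

theorem contDiffOn_scaleSq (hG : IsMetricOn G U) (hs : ContDiffOn ℝ ∞ s U) :
    ContDiffOn ℝ ∞ (scaleSq G s) U :=
  .sum fun A _ => .sum fun B _ => ((contDiffOn_ofReal (hG.contDiffOn_tractorMetric A B)).mul
    (hG.contDiffOn_scaleTractor hs A)).mul (hG.contDiffOn_scaleTractor hs B)

theorem contDiffOn_IdotD (hG : IsMetricOn G U) (hs : ContDiffOn ℝ ∞ s U) (hf : ContDiffOn ℝ ∞ f U) :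
    ContDiffOn ℝ ∞ (IdotD G s w f) U :=
  .sum fun A _ => .sum fun B _ => ((contDiffOn_ofReal (hG.contDiffOn_tractorMetric A B)).mul
    (hG.contDiffOn_scaleTractor hs A)).smul (hG.contDiffOn_thomasD hf B)

end IsMetricOn

/-- `s` represents, on the open set `U` and in the metric `G`, a scale whose `I²` is nowhere
zero. -/
structure IsScaleOn (G : Coord d → Matrix (Fin d) (Fin d) ℝ) (s : Coord d → ℝ)
    (U : Set (Coord d)) : Prop extends IsMetricOn G U where
  contDiffOn_scale : ContDiffOn ℝ ∞ s U
  scaleSq_ne_zero : ∀ x ∈ U, scaleSq G s x ≠ 0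

namespace IsScaleOn

theorem contDiffOn_scale_pow (hs : IsScaleOn G s U) (n : ℕ) :
    ContDiffOn ℝ ∞ (fun y => (s y : ℂ) ^ n) U :=
  (contDiffOn_ofReal hs.contDiffOn_scale).pow n

theorem contDiffOn_yOp (hs : IsScaleOn G s U) (hf : ContDiffOn ℝ ∞ f U) :
    ContDiffOn ℝ ∞ (yOp G s w f) U := by
  suffices ContDiffOn ℝ ∞ (fun x => -(scaleSq G s x)⁻¹ • IdotD G s w f x) U from
    this.congr fun x _ => by rw [yOp, one_div]
  exact ((hs.contDiffOn_scaleSq hs.contDiffOn_scale).inv hs.scaleSq_ne_zero).neg.smul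
    (hs.contDiffOn_IdotD hs.contDiffOn_scale hf)

theorem contDiffOn_wpow_yOp (hs : IsScaleOn G s U) (hf : ContDiffOn ℝ ∞ f U) (m : ℕ) :
    ContDiffOn ℝ ∞ (wpow (yOp G s) w m f) U := by
  induction m with
  | zero => exact hf
  | succ m ih => exact hs.contDiffOn_yOp ih

theorem contDiffOn_normalOrdered (hs : IsScaleOn G s U) (hf : ContDiffOn ℝ ∞ f U)
    (K : PowerSeries ℂ) (ℓ : ℕ) : ContDiffOn ℝ ∞ (normalOrdered G s w K ℓ f) U :=
  .sum fun m _ => (contDiffOn_const.mul (hs.contDiffOn_scale_pow m)).smul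
    (hs.contDiffOn_wpow_yOp hf m)

end IsScaleOn

end Smoothness

section Cancellation

variable {X 𝕜 V : Type*} [TopologicalSpace X] [NormedField 𝕜] [NormedAddCommGroup V]
  [NormedSpace 𝕜 V]

theorem eq_zero_of_pow_smul_eq_pow_succ_smul {s : X → 𝕜} {F H : X → V} {p : X}
    (hs : ContinuousAt s p) (hF : ContinuousAt F p) (hH : ContinuousAt H p) (hp : s p = 0)
    (hne : ∃ᶠ x in 𝓝 p, s x ≠ 0) {n : ℕ}
    (heq : ∀ᶠ x in 𝓝 p, s x ^ n • F x = s x ^ (n + 1) • H x) : F p = 0 := by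
  have lim : Tendsto (fun x => F x - s x • H x) (𝓝 p) (𝓝 (F p)) := by
    have h := hF.tendsto.sub (hs.tendsto.smul hH.tendsto)
    rwa [hp, zero_smul, sub_zero] at h
  have vanish : ∃ᶠ x in 𝓝 p, F x - s x • H x ∈ ({0} : Set V) := by
    refine (hne.and_eventually heq).mono fun x ⟨hx, hxeq⟩ => sub_eq_zero.2 ?_
    rw [pow_succ, mul_smul] at hxeq
    exact smul_right_injective V (pow_ne_zero n hx) hxeq
  exact isClosed_singleton.mem_of_frequently_of_tendsto vanish lim

end Cancellation

section FormalSolutions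

variable {d k : ℕ} {G : Coord d → Matrix (Fin d) (Fin d) ℝ} {s : Coord d → ℝ} {w : ℂ}
  {U : Set (Coord d)} {f : TField d k} {x : Coord d}

/-- The amount by which the coefficients of `K` fail the recursion
`(m + 1) (h - m - 2) α_{m+1} = α_m` at `m`. -/
def recursionDefect (h : ℂ) (K : PowerSeries ℂ) (m : ℕ) : ℂ :=
  PowerSeries.coeff (m + 1) K * ((m + 1) * (h - m - 2)) - PowerSeries.coeff m K

theorem wpow_eq_smul_wpow_yOp (hU : IsOpen U) {P : ℂ → TField d k → TField d k} {b : ℂ}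
    (hP : ∀ w f, ∀ x ∈ U, P w f x = b • yOp G s w f x) (f : TField d k) (m : ℕ) (hx : x ∈ U) :
    wpow P w m f x = b ^ m • wpow (yOp G s) w m f x := by
  induction m generalizing x with
  | zero => rw [pow_zero, one_smul, wpow, wpow]
  | succ m ih =>
    have ih' : wpow P w m f =ᶠ[𝓝 x] fun y => b ^ m • wpow (yOp G s) w m f y := by
      filter_upwards [hU.mem_nhds hx] with y hy using ih hy
    rw [wpow, hP _ _ x hx, wpow, yOp, yOp, IdotD_congr ih', IdotD_const_smul]
    module

theorem normIdotD_eq_neg_yOp (w : ℂ) (f : TField d k) (x : Coord d) :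
    normIdotD G s w f x = -(1 : ℂ) • yOp G s w f x := by
  rw [normIdotD, yOp, neg_smul, neg_smul, one_smul, neg_neg]

theorem IdotD_eq_neg_scaleSq_smul_yOp (hx : scaleSq G s x ≠ 0) (w : ℂ) (f : TField d k) :
    IdotD G s w f x = -scaleSq G s x • yOp G s w f x := by
  rw [yOp, smul_smul, neg_mul_neg, mul_one_div_cancel hx, one_smul]

namespace IsScaleOn

variable [NeZero d]

theorem IdotD_scale_pow_smul (hs : IsScaleOn G s U) (hf : ContDiffOn ℝ ∞ f U) (n : ℕ)
    (hx : x ∈ U) :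
    IdotD G s (w + (n + 1)) (fun y => (s y : ℂ) ^ (n + 1) • f y) x =
      (s x : ℂ) ^ (n + 1) • IdotD G s w f x
        + ((n + 1) * (d + 2 * w + n) * (s x : ℂ) ^ n * scaleSq G s x) • f x := by
  have commutator : ∀ {v : ℂ} {g : TField d k}, ContDiffOn ℝ ∞ g U →
      IdotD G s (v + 1) (fun y => (s y : ℂ) • g y) x =
        (s x : ℂ) • IdotD G s v g x + ((d + 2 * v) * scaleSq G s x) • g x := fun hg =>
    IdotD_scale_smul (hs.differentiableAt_tractorConn hx) (hs.isSymm x hx)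
      (hs.contDiffAt hs.contDiffOn_scale hx) (hs.contDiffAt hg hx)
  induction n with
  | zero => simp only [zero_add, pow_one, Nat.cast_zero, commutator hf, pow_zero, add_zero,
      one_mul, mul_one]
  | succ n ih =>
    have factor : (fun y => (s y : ℂ) ^ (n + 1 + 1) • f y) =
        fun y => (s y : ℂ) • (s y : ℂ) ^ (n + 1) • f y := by
      funext y
      rw [smul_smul, pow_succ' _ (n + 1)]
    have weight : w + (((n + 1 : ℕ) : ℂ) + 1) = w + (n + 1) + 1 := by push_cast; ring
    rw [factor, weight, commutator (g := fun y => (s y : ℂ) ^ (n + 1) • f y)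
      ((hs.contDiffOn_scale_pow _).smul hf), ih]
    push_cast
    module

theorem yOp_scale_pow_smul (hs : IsScaleOn G s U) (hf : ContDiffOn ℝ ∞ f U) (n : ℕ)
    (hx : x ∈ U) :
    yOp G s (w + (n + 1)) (fun y => (s y : ℂ) ^ (n + 1) • f y) x =
      (s x : ℂ) ^ n • ((s x : ℂ) • yOp G s w f x - ((n + 1) * (d + 2 * w + n)) • f x) := by
  have := hs.scaleSq_ne_zero x hx
  rw [yOp, yOp, hs.IdotD_scale_pow_smul hf n hx]
  match_scalars <;> field_simp
  ring

theorem wpow_yOp_scale_pow_smul (hs : IsScaleOn G s U)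
    (hw : ∀ m : ℕ, (d + 2 * w : ℂ) ≠ m + 2) (hf : ContDiffOn ℝ ∞ f U) (j i : ℕ) :
    ∃ c : ℂ, c ≠ 0 ∧ ∃ r : TField d k, ContDiffOn ℝ ∞ r U ∧ ∀ x ∈ U,
      wpow (yOp G s) w j (fun y => (s y : ℂ) ^ (j + i) • f y) x =
        (s x : ℂ) ^ i • (c • f x + (s x : ℂ) • r x) := by
  induction j generalizing i with
  | zero =>
    refine ⟨1, one_ne_zero, 0, contDiffOn_const, fun x _ => ?_⟩
    simp only [wpow, zero_add, one_smul, Pi.zero_apply, smul_zero, add_zero]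
  | succ j ih =>
    obtain ⟨c, hc, r, hr, hcr⟩ := ih (i + 1)
    set g : TField d k := fun y => c • f y + (s y : ℂ) • r y with hg_def
    have hg : ContDiffOn ℝ ∞ g U :=
      (hf.const_smul c).add ((contDiffOn_ofReal hs.contDiffOn_scale).smul hr)
    set b : ℂ := (i + 1) * (d + 2 * (w - j - (i + 1)) + i) with hb_def
    have hb : b ≠ 0 := by
      refine mul_ne_zero i.cast_add_one_ne_zero fun h => hw (2 * j + i) ?_
      push_cast
      linear_combination h
    refine ⟨-b * c, mul_ne_zero (neg_ne_zero.2 hb) hc,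
      fun y => yOp G s (w - j - (i + 1)) g y - b • r y,
      (hs.contDiffOn_yOp hg).sub (hr.const_smul b), fun x hx => ?_⟩
    have inner : wpow (yOp G s) w j (fun y => (s y : ℂ) ^ (j + 1 + i) • f y) =ᶠ[𝓝 x]
        fun y => (s y : ℂ) ^ (i + 1) • g y := by
      filter_upwards [hs.isOpen.mem_nhds hx] with y hy
      rw [← hcr y hy, add_right_comm, add_assoc]
    have hy := hs.yOp_scale_pow_smul (w := w - j - (i + 1)) hg i hx
    rw [sub_add_cancel, ← hb_def] at hy
    rw [wpow, yOp, IdotD_congr inner, ← yOp, hy, hg_def]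
    module

theorem IdotD_normalOrdered_succ (hs : IsScaleOn G s U) (hf : ContDiffOn ℝ ∞ f U)
    (K : PowerSeries ℂ) (ℓ : ℕ) (hx : x ∈ U) :
    IdotD G s w (normalOrdered G s w K (ℓ + 1) f) x = IdotD G s w (normalOrdered G s w K ℓ f) x
      + (PowerSeries.coeff (ℓ + 1) K * (s x : ℂ) ^ (ℓ + 1)) •
          IdotD G s (w - (ℓ + 1 : ℕ)) (wpow (yOp G s) w (ℓ + 1) f) x
      + (PowerSeries.coeff (ℓ + 1) K * ((ℓ + 1) * (d + 2 * w - ℓ - 2)) * (s x : ℂ) ^ ℓ *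
          scaleSq G s x) • wpow (yOp G s) w (ℓ + 1) f x := by
  have hy := hs.contDiffOn_wpow_yOp (w := w) hf (ℓ + 1)
  have hsy : ContDiffOn ℝ ∞ (fun y => (s y : ℂ) ^ (ℓ + 1) • wpow (yOp G s) w (ℓ + 1) f y) U :=
    (hs.contDiffOn_scale_pow _).smul hy
  have split : normalOrdered G s w K (ℓ + 1) f = fun y => normalOrdered G s w K ℓ f y +
      PowerSeries.coeff (ℓ + 1) K • ((s y : ℂ) ^ (ℓ + 1) • wpow (yOp G s) w (ℓ + 1) f y) := by
    funext y
    simp only [normalOrdered, Finset.sum_range_succ _ (ℓ + 1), smul_smul]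
  have last := hs.IdotD_scale_pow_smul (w := w - (ℓ + 1 : ℕ)) hy ℓ hx
  rw [show w - ((ℓ + 1 : ℕ) : ℂ) + (ℓ + 1) = w by push_cast; ring] at last
  rw [split, IdotD_add (hs.differentiableAt_tractorConn hx)
    (hs.contDiffAt (hs.contDiffOn_normalOrdered hf K ℓ) hx)
    (hs.contDiffAt (hsy.const_smul _) hx), IdotD_const_smul, last]
  push_cast
  module

theorem IdotD_normalOrdered (hs : IsScaleOn G s U) (hf : ContDiffOn ℝ ∞ f U)
    (K : PowerSeries ℂ) (ℓ : ℕ) (hx : x ∈ U) :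
    IdotD G s w (normalOrdered G s w K ℓ f) x =
      (PowerSeries.coeff ℓ K * (s x : ℂ) ^ ℓ) • IdotD G s (w - ℓ) (wpow (yOp G s) w ℓ f) x
        + ∑ m ∈ Finset.range ℓ, (recursionDefect (d + 2 * w) K m * (s x : ℂ) ^ m * scaleSq G s x) •
            wpow (yOp G s) w (m + 1) f x := by
  induction ℓ with
  | zero =>
    have constant : normalOrdered G s w K 0 f = fun y => PowerSeries.coeff 0 K • f y := by
      funext y
      simp only [normalOrdered, wpow, zero_add, Finset.sum_range_one, pow_zero, mul_one]
    simp only [constant, IdotD_const_smul, wpow, pow_zero, mul_one, Nat.cast_zero, sub_zero,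
      Finset.range_zero, Finset.sum_empty, add_zero]
  | succ ℓ ih =>
    have next : IdotD G s (w - ℓ) (wpow (yOp G s) w ℓ f) x =
        -(scaleSq G s x • wpow (yOp G s) w (ℓ + 1) f x) := by
      rw [IdotD_eq_neg_scaleSq_smul_yOp (hs.scaleSq_ne_zero x hx), neg_smul, wpow]
    rw [hs.IdotD_normalOrdered_succ hf K ℓ hx, ih, next, Finset.sum_range_succ, recursionDefect]
    push_cast
    module

theorem IdotD_normalOrdered_of_recursion (hs : IsScaleOn G s U) (hf : ContDiffOn ℝ ∞ f U)
    {K : PowerSeries ℂ} {ℓ : ℕ} (hK : ∀ m < ℓ, recursionDefect (d + 2 * w) K m = 0) (hx : x ∈ U) :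
    IdotD G s w (normalOrdered G s w K ℓ f) x =
      (s x : ℂ) ^ ℓ • PowerSeries.coeff ℓ K • IdotD G s (w - ℓ) (wpow (yOp G s) w ℓ f) x := by
  rw [hs.IdotD_normalOrdered hf K ℓ hx, Finset.sum_eq_zero fun m hm => by
    rw [hK m (Finset.mem_range.1 hm), zero_mul, zero_mul, zero_smul], add_zero, mul_comm, mul_smul]

theorem recursionDefect_eq_zero (hs : IsScaleOn G s U) {K : PowerSeries ℂ} {m : ℕ}
    (hK : ∀ j < m, recursionDefect (d + 2 * w) K j = 0) (hf : ContDiffOn ℝ ∞ f U) {p : Coord d}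
    (hp : p ∈ U) (hsp : s p = 0) (hfp : wpow (yOp G s) w (m + 1) f p ≠ 0) {r : TField d k}
    (hr : ContDiffOn ℝ ∞ r U)
    (heq : ∀ x ∈ U, IdotD G s w (normalOrdered G s w K (m + 1) f) x = (s x : ℂ) ^ (m + 1) • r x) :
    recursionDefect (d + 2 * w) K m = 0 := by
  have hU := hs.isOpen.mem_nhds hp
  have hy := hs.contDiffOn_wpow_yOp (w := w) hf (m + 1)
  let F : TField d k := fun x =>
    (recursionDefect (d + 2 * w) K m * scaleSq G s x) • wpow (yOp G s) w (m + 1) f x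
  let H : TField d k := fun x => r x - PowerSeries.coeff (m + 1) K •
    IdotD G s (w - (m + 1 : ℕ)) (wpow (yOp G s) w (m + 1) f) x
  have hF : ContinuousOn F U := ((contDiffOn_const.mul
    (hs.contDiffOn_scaleSq hs.contDiffOn_scale)).smul hy).continuousOn
  have hH : ContinuousOn H U :=
    (hr.sub ((hs.contDiffOn_IdotD hs.contDiffOn_scale hy).const_smul _)).continuousOn
  have factor : ∀ x ∈ U, (s x : ℂ) ^ m • F x = (s x : ℂ) ^ (m + 1) • H x := by
    intro x hx
    have h := hs.IdotD_normalOrdered (w := w) hf K (m + 1) hx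
    rw [heq x hx, Finset.sum_range_succ, Finset.sum_eq_zero fun j hj => by
      rw [hK j (Finset.mem_range.1 hj), zero_mul, zero_mul, zero_smul], zero_add] at h
    simp only [F, H, smul_sub, h]
    module
  have hFp : F p = 0 := eq_zero_of_pow_smul_eq_pow_succ_smul
    ((contDiffOn_ofReal hs.contDiffOn_scale).continuousOn.continuousAt hU)
    (hF.continuousAt hU) (hH.continuousAt hU) (by rw [hsp, Complex.ofReal_zero])
    ((frequently_scale_ne_zero (hs.scaleSq_ne_zero p hp)).mono fun x hx => by exact_mod_cast hx)
    (eventually_of_mem hU factor)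
  exact (mul_eq_zero.1 ((smul_eq_zero.1 hFp).resolve_right hfp)).resolve_right
    (hs.scaleSq_ne_zero p hp)

end IsScaleOn

end FormalSolutions

section Bessel

open scoped Nat

theorem pochhammer_eq_ascPochhammer_eval (a : ℂ) (m : ℕ) :
    pochhammer a m = (ascPochhammer ℂ m).eval (a - m + 1) := by
  rw [pochhammer, ← descPochhammer_eval_eq_prod_range, descPochhammer_eval_eq_ascPochhammer]

theorem pochhammer_add_one_sub (h : ℂ) (m : ℕ) :
    pochhammer (m + 1 - h) m = (ascPochhammer ℂ m).eval (2 - h) := by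
  rw [pochhammer_eq_ascPochhammer_eval]
  congr 1
  ring

/-- The series `K` of the formal solution operator, with `h` for `h₀ = d + 2w₀`. -/
def solutionSeries (h : ℂ) : PowerSeries ℂ :=
  .mk fun m => (-1) ^ m / (m ! * pochhammer (m + 1 - h) m)

variable {h : ℂ}

theorem coeff_solutionSeries (h : ℂ) (m : ℕ) : PowerSeries.coeff m (solutionSeries h) =
    (-1) ^ m / (m ! * pochhammer (m + 1 - h) m) :=
  PowerSeries.coeff_mk m _

theorem constantCoeff_solutionSeries (h : ℂ) :
    PowerSeries.constantCoeff (solutionSeries h) = 1 := by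
  rw [← PowerSeries.coeff_zero_eq_constantCoeff_apply, coeff_solutionSeries, pochhammer]
  simp only [pow_zero, Nat.factorial_zero, Nat.cast_one, Finset.range_zero, Finset.prod_empty,
    mul_one, div_one]

theorem coeff_solutionSeries_smul_wpow_yOp {d k : ℕ} {G : Coord d → Matrix (Fin d) (Fin d) ℝ}
    {s : Coord d → ℝ} {U : Set (Coord d)} {x : Coord d} (hU : IsOpen U) (hx : x ∈ U)
    {P : ℂ → TField d k → TField d k} {c : ℂ} (hc : c ≠ 0)
    (hP : ∀ w f, ∀ x ∈ U, P w f x = -c • yOp G s w f x) (h t w : ℂ) (f : TField d k) (m : ℕ) :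
    (PowerSeries.coeff m (solutionSeries h) * t) • wpow (yOp G s) w m f x =
      (t * (1 / (m ! * pochhammer (m + 1 - h) m * c ^ m))) • wpow P w m f x := by
  rw [wpow_eq_smul_wpow_yOp hU hP f m hx, coeff_solutionSeries, smul_smul, neg_pow c]
  congr 1
  field_simp

theorem pochhammer_add_one_sub_ne_zero (hh : ∀ m : ℕ, h ≠ m + 2) (m : ℕ) :
    pochhammer (m + 1 - h) m ≠ 0 := by
  rw [pochhammer_add_one_sub, Ne, ascPochhammer_eval_eq_zero_iff]
  rintro ⟨j, -, hj⟩
  exact hh j (by linear_combination -hj)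

theorem recursionDefect_solutionSeries (hh : ∀ m : ℕ, h ≠ m + 2) (m : ℕ) :
    recursionDefect h (solutionSeries h) m = 0 := by
  have hm := pochhammer_add_one_sub_ne_zero hh m
  have hm' := pochhammer_add_one_sub_ne_zero hh (m + 1)
  rw [pochhammer_add_one_sub] at hm hm'
  rw [recursionDefect, coeff_solutionSeries, coeff_solutionSeries, pochhammer_add_one_sub,
    pochhammer_add_one_sub, sub_eq_zero]
  rw [ascPochhammer_succ_eval] at hm' ⊢
  rw [Nat.factorial_succ]
  push_cast
  field_simp [m.cast_add_one_ne_zero, right_ne_zero_of_mul hm', m.factorial_ne_zero]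
  ring

theorem eq_solutionSeries_of_recursionDefect_eq_zero (hh : ∀ m : ℕ, h ≠ m + 2) {K : PowerSeries ℂ}
    (hK₀ : PowerSeries.constantCoeff K = 1) (hK : ∀ m, recursionDefect h K m = 0) :
    K = solutionSeries h := by
  ext m
  induction m with
  | zero => rw [PowerSeries.coeff_zero_eq_constantCoeff_apply, hK₀,
      PowerSeries.coeff_zero_eq_constantCoeff_apply, constantCoeff_solutionSeries]
  | succ m ih =>
    have factor_ne_zero : (m + 1) * (h - m - 2) ≠ 0 :=
      mul_ne_zero m.cast_add_one_ne_zero fun hm => hh m (by linear_combination hm)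
    refine mul_right_cancel₀ factor_ne_zero ?_
    rw [sub_eq_zero.1 (hK m), ih, sub_eq_zero.1 (recursionDefect_solutionSeries hh m)]

theorem Gamma_two_sub_mul_pochhammer (hh : ∀ m : ℕ, h ≠ m + 2) (m : ℕ) :
    Complex.Gamma (2 - h) * pochhammer (m + 1 - h) m = Complex.Gamma (m + (1 - h) + 1) := by
  have hpole : ∀ j : ℕ, 2 - h ≠ -j := fun j hj => hh j (by linear_combination -hj)
  rw [pochhammer_add_one_sub, ← Complex.Gamma_add_nat_div_Gamma_eq _ hpole,
    mul_div_cancel₀ _ (Complex.Gamma_ne_zero hpole)]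
  congr 1
  ring

theorem summable_pow_div_factorial_mul_Gamma (ν z : ℂ) :
    Summable fun m : ℕ => z ^ m / (m ! * Complex.Gamma (m + ν + 1)) := by
  have radius : (Complex.regularizedHGFunSeries 0 {ν + 1}).radius = ⊤ :=
    Complex.radius_regularizedHGFunSeries_eq_top (Nat.zero_le _)
  refine ((Complex.regularizedHGFunSeries 0 {ν + 1}).summable (x := z)
    (by simp only [radius, Metric.eball_top, Set.mem_univ])).congr fun m => ?_
  rw [Complex.regularizedHGFunSeries, FormalMultilinearSeries.ofScalars_apply_eq,
    Complex.regularizedHGFunCoeff, Multiset.map_singleton, Multiset.prod_singleton,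
    Multiset.map_zero, Multiset.prod_zero, smul_eq_mul, one_div_mul_eq_div, add_right_comm ν,
    add_comm ν]

theorem hasSum_besselJ (ν u : ℂ) :
    HasSum (fun m : ℕ => (u / 2) ^ ν *
      ((-1) ^ m / (m ! * Complex.Gamma (m + ν + 1)) * (u / 2) ^ (2 * m))) (besselJ ν u) := by
  refine (Summable.hasSum ?_).mul_left _
  refine (summable_pow_div_factorial_mul_Gamma ν (-(u / 2) ^ 2)).congr fun m => ?_
  rw [neg_pow, pow_mul, mul_div_right_comm]

theorem cpow_half_cpow (z a : ℂ) : (z ^ (1 / 2 : ℂ)) ^ a = z ^ (a / 2) := by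
  have im_eq : (Complex.log z * (1 / 2 : ℂ)).im = Complex.arg z / 2 := by
    rw [mul_one_div, Complex.div_ofNat_im, Complex.log_im]
  rw [← Complex.cpow_mul, one_div_mul_eq_div]
  · rw [im_eq]; linarith [Complex.neg_pi_lt_arg z, Real.pi_pos]
  · rw [im_eq]; linarith [Complex.arg_le_pi z, Real.pi_pos]

theorem hasSum_solutionSeries (hh : ∀ m : ℕ, h ≠ m + 2) {z : ℂ} (hz : z ≠ 0) :
    HasSum (fun m => PowerSeries.coeff m (solutionSeries h) * z ^ m)
      (z ^ ((h - 1) / 2) * Complex.Gamma (2 - h) * besselJ (1 - h) (2 * z ^ (1 / 2 : ℂ))) := by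
  have hΓ : Complex.Gamma (2 - h) ≠ 0 :=
    Complex.Gamma_ne_zero fun j hj => hh j (by linear_combination -hj)
  have sqrt_sq : (z ^ (1 / 2 : ℂ)) ^ 2 = z := by
    rw [one_div]
    exact Complex.cpow_ofNat_inv_pow z 2
  have powers_cancel : z ^ ((h - 1) / 2) * (z ^ (1 / 2 : ℂ)) ^ (1 - h) = 1 := by
    rw [cpow_half_cpow, ← Complex.cpow_add _ _ hz, ← add_div, sub_add_sub_cancel, sub_self,
      zero_div, Complex.cpow_zero]
  refine ((hasSum_besselJ (1 - h) (2 * z ^ (1 / 2 : ℂ))).mul_left _).congr_fun fun m => ?_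
  have := pochhammer_add_one_sub_ne_zero hh m
  rw [coeff_solutionSeries, ← Gamma_two_sub_mul_pochhammer hh,
    mul_div_cancel_left₀ _ (two_ne_zero' ℂ), pow_mul, sqrt_sq, mul_mul_mul_comm, powers_cancel]
  field_simp

end Bessel

section Manifold

variable {d k : ℕ} {M : Type*} [TopologicalSpace M] [ChartedSpace (Coord d) M]
  {φ : OpenPartialHomeomorph M (Coord d)} {C : ConformalStructure d M} {Φ : TensorPart d k} {w : ℂ}

theorem mdifferentiable_symm_of_mem_maximalAtlas (hφ : φ ∈ IsManifold.maximalAtlas (𝓡 d) ∞ M) :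
    φ.symm.MDifferentiable (𝓡 d) (𝓡 d) :=
  ⟨(contMDiffOn_symm_of_mem_maximalAtlas hφ).mdifferentiableOn (by simp),
    (contMDiffOn_of_mem_maximalAtlas hφ).mdifferentiableOn (by simp)⟩

theorem det_gram_ne_zero {g : ∀ p : M, LinearMap.BilinForm ℝ (TangentSpace (𝓡 d) p)}
    (hφ : φ ∈ IsManifold.maximalAtlas (𝓡 d) ∞ M) {x : Coord d} (hx : x ∈ φ.target)
    (hg : (g (φ.symm x)).SeparatingLeft) : (gram g φ x).det ≠ 0 := by
  let L : Coord d ≃L[ℝ] TangentSpace (𝓡 d) (φ.symm x) :=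
    (mdifferentiable_symm_of_mem_maximalAtlas hφ).mfderiv hx
  let b : Module.Basis (Fin d) ℝ (TangentSpace (𝓡 d) (φ.symm x)) :=
    (EuclideanSpace.basisFun (Fin d) ℝ).toBasis.map L.toLinearEquiv
  have gram_eq : gram g φ x = LinearMap.toMatrix₂ b b (g (φ.symm x)) := by
    ext i j
    rw [LinearMap.toMatrix₂_apply, Module.Basis.map_apply, Module.Basis.map_apply,
      OrthonormalBasis.coe_toBasis, EuclideanSpace.basisFun_apply, EuclideanSpace.basisFun_apply]
    rfl
  rw [gram_eq]
  exact (LinearMap.separatingLeft_iff_det_ne_zero b).1 hg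

theorem PseudoMetric.isMetricOn_gram (g : PseudoMetric d M)
    (hφ : φ ∈ IsManifold.maximalAtlas (𝓡 d) ∞ M) : IsMetricOn (gram g.form φ) φ.target where
  isOpen := φ.open_target
  contDiffOn_apply := g.smooth φ hφ
  isSymm _ _ := Matrix.IsSymm.ext fun _ _ => g.symm _ _ _
  det_ne_zero _ hx := det_gram_ne_zero hφ hx (g.nondegenerate _)

theorem contDiffOn_comp_symm (hφ : φ ∈ IsManifold.maximalAtlas (𝓡 d) ∞ M) {q : M → ℝ}
    (hq : ContMDiff (𝓡 d) 𝓘(ℝ, ℝ) ∞ q) : ContDiffOn ℝ ∞ (fun x => q (φ.symm x)) φ.target :=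
  contMDiffOn_iff_contDiffOn.1
    (hq.comp_contMDiffOn (contMDiffOn_symm_of_mem_maximalAtlas hφ))

theorem RealScale.isScaleOn {σ : RealScale C} (hI : ScaleSqNowhereZero σ)
    {g : PseudoMetric d M} (hg : g ∈ C.metrics) (hφ : φ ∈ IsManifold.maximalAtlas (𝓡 d) ∞ M) :
    IsScaleOn (gram g.form φ) (σ.inChart g φ) φ.target where
  toIsMetricOn := g.isMetricOn_gram hφ
  contDiffOn_scale := contDiffOn_comp_symm hφ (σ.smooth g hg)
  scaleSq_ne_zero := hI g hg φ hφ

theorem tensorPowerAct_smul (S : Matrix (TIdx d) (TIdx d) ℝ) (c : ℂ) (T : TTensor d k) :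
    tensorPowerAct S (c • T) = c • tensorPowerAct S T := by
  ext B
  simp only [tensorPowerAct, Pi.smul_apply, smul_eq_mul, Finset.mul_sum, mul_left_comm c]

/-- The product of a smooth function on the manifold and a section of a weighted tractor bundle,
with unchanged weight: the function is not a density. -/
def TractorSection.functionSMul (q : M → ℝ) (hq : ContMDiff (𝓡 d) 𝓘(ℝ, ℝ) ∞ q)
    (u : TractorSection C Φ w) : TractorSection C Φ w where
  comp g φ x := (q (φ.symm x) : ℂ) • u.comp g φ x
  smooth g hg φ hφ := (contDiffOn_ofReal (contDiffOn_comp_symm hφ hq)).smul (u.smooth g hg φ hφ)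
  mem g hg φ hφ x hx := (Φ.space _).smul_mem _ (u.mem g hg φ hφ x hx)
  transform g hg g' hg' Υ hΥ φ hφ ψ hψ p hp := by
    rw [φ.left_inv hp.1, ψ.left_inv hp.2, u.transform g hg g' hg' Υ hΥ φ hφ ψ hψ p hp,
      tensorPowerAct_smul, smul_comm]

variable [NeZero d] {σ : RealScale C} {K : PowerSeries ℂ}

theorem isFormalSolutionOperator_of_recursionDefect_eq_zero (hI : ScaleSqNowhereZero σ)
    (hK₀ : PowerSeries.constantCoeff K = 1) (hK : ∀ m, recursionDefect (d + 2 * w) K m = 0) :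
    IsFormalSolutionOperator σ Φ w K := by
  refine ⟨hK₀, fun f₀ ℓ g hg φ hφ => ?_⟩
  have hs := RealScale.isScaleOn hI hg hφ
  have hf := f₀.smooth g hg φ hφ
  exact ⟨_, (hs.contDiffOn_IdotD hs.contDiffOn_scale (hs.contDiffOn_wpow_yOp hf ℓ)).const_smul _,
    fun x hx => hs.IdotD_normalOrdered_of_recursion hf (fun m _ => hK m) hx⟩

theorem IsFormalSolutionOperator.recursionDefect_eq_zero (hI : ScaleSqNowhereZero σ)
    (hw : ∀ m : ℕ, (d + 2 * w : ℂ) ≠ m + 2) (hK : IsFormalSolutionOperator σ Φ w K)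
    {u : TractorSection C Φ w} (hu : u.NonzeroAlong σ) (m : ℕ) :
    recursionDefect (d + 2 * w) K m = 0 := by
  obtain ⟨g, hg, φ, hφ, p, hp, hσp, hup⟩ := hu
  have hs := RealScale.isScaleOn hI hg hφ
  have hφp := φ.map_source hp
  have hσφp : σ.inChart g φ (φ p) = 0 := by rw [RealScale.inChart, φ.left_inv hp, hσp]
  induction m using Nat.strong_induction_on with
  | h m ih =>
    let f := u.functionSMul (fun q => σ.val g q ^ (m + 1)) ((σ.smooth g hg).pow (m + 1))
    have hf_eq : f.comp g φ = fun x => (σ.inChart g φ x : ℂ) ^ (m + 1 + 0) • u.comp g φ x := by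
      funext x
      simp only [f, TractorSection.functionSMul, Complex.ofReal_pow, RealScale.inChart, add_zero]
    obtain ⟨c, hc, r, -, hcr⟩ := hs.wpow_yOp_scale_pow_smul hw (u.smooth g hg φ hφ) (m + 1) 0
    have hfp : wpow (yOp (gram g.form φ) (σ.inChart g φ)) w (m + 1) (f.comp g φ) (φ p) ≠ 0 := by
      rw [hf_eq, hcr _ hφp, hσφp, pow_zero, one_smul, Complex.ofReal_zero, zero_smul, add_zero]
      exact smul_ne_zero hc hup
    obtain ⟨q, hq, heq⟩ := hK.2 f (m + 1) g hg φ hφ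
    exact hs.recursionDefect_eq_zero ih (f.smooth g hg φ hφ) hφp hσφp hfp hq heq

theorem IsFormalSolutionOperator.eq_solutionSeries (hI : ScaleSqNowhereZero σ)
    (hw : ∀ m : ℕ, (d + 2 * w : ℂ) ≠ m + 2) (hK : IsFormalSolutionOperator σ Φ w K)
    {u : TractorSection C Φ w} (hu : u.NonzeroAlong σ) : K = solutionSeries (d + 2 * w) :=
  eq_solutionSeries_of_recursionDefect_eq_zero hw hK.1 (hK.recursionDefect_eq_zero hI hw hu)

end Manifold

end DegenerateLaplacian

end

open DegenerateLaplacian in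
theorem proposition5p3 {d k : ℕ} (hd : 3 ≤ d)
    {M : Type*} [TopologicalSpace M] [ChartedSpace (Coord d) M] [IsManifold (𝓡 d) ∞ M]
    (C : ConformalStructure d M) (σ : RealScale C) (hI : ScaleSqNowhereZero σ)
    (Φ : TensorPart d k) (w₀ h₀ : ℂ) (hh₀ : h₀ = d + 2 * w₀)
    (hw₀ : ∀ j : ℤ, 2 ≤ j → w₀ ≠ ((j : ℂ) - d) / 2) :
    ∃ K : PowerSeries ℂ,
      -- `:K:` is a formal solution operator on `𝓔^Φ[w₀]`
      IsFormalSolutionOperator σ Φ w₀ K ∧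
      -- it is the only one, as soon as `𝓔^Φ` does not vanish along the zero locus of `σ`
      ((∃ u : TractorSection C Φ w₀, u.NonzeroAlong σ) →
        ∀ K' : PowerSeries ℂ, IsFormalSolutionOperator σ Φ w₀ K' → K' = K) ∧
      -- its terms are `σ^m (1 / (m! (m+1-h₀)_m)) ((1/I²) I·D)^m f₀`
      (∀ f₀ : TractorSection C Φ w₀, ∀ m : ℕ, ∀ g ∈ C.metrics,
        ∀ φ ∈ IsManifold.maximalAtlas (𝓡 d) ∞ M, ∀ x ∈ φ.target,
        (PowerSeries.coeff m K * (σ.inChart g φ x : ℂ) ^ m) •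
            wpow (yOp (gram g.form φ) (σ.inChart g φ)) w₀ m (f₀.comp g φ) x
          = ((σ.inChart g φ x : ℂ) ^ m *
              (1 / ((m.factorial : ℂ) * pochhammer (m + 1 - h₀) m))) •
            wpow (normIdotD (gram g.form φ) (σ.inChart g φ)) w₀ m (f₀.comp g φ) x) ∧
      -- when `I²` is constant, they are `σ^m (1 / (m! (m+1-h₀)_m (I²)^m)) (I·D)^m f₀`
      (∀ c : ℂ, (∀ g ∈ C.metrics, ∀ φ ∈ IsManifold.maximalAtlas (𝓡 d) ∞ M, ∀ x ∈ φ.target,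
          scaleSq (gram g.form φ) (σ.inChart g φ) x = c) →
        ∀ f₀ : TractorSection C Φ w₀, ∀ m : ℕ, ∀ g ∈ C.metrics,
        ∀ φ ∈ IsManifold.maximalAtlas (𝓡 d) ∞ M, ∀ x ∈ φ.target,
        (PowerSeries.coeff m K * (σ.inChart g φ x : ℂ) ^ m) •
            wpow (yOp (gram g.form φ) (σ.inChart g φ)) w₀ m (f₀.comp g φ) x
          = ((σ.inChart g φ x : ℂ) ^ m *
              (1 / ((m.factorial : ℂ) * pochhammer (m + 1 - h₀) m * c ^ m))) •
            wpow (IdotD (gram g.form φ) (σ.inChart g φ)) w₀ m (f₀.comp g φ) x) ∧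
      -- the denominators do not vanish
      (∀ m : ℕ, pochhammer (m + 1 - h₀) m ≠ 0) ∧
      -- `K(z) = ∑ (-z)^m / (m! (m+1-h₀)_m) = z^{(h₀-1)/2} Γ(2-h₀) J_{1-h₀}(2√z)`
      (∀ m : ℕ, PowerSeries.coeff m K =
        (-1) ^ m / ((m.factorial : ℂ) * pochhammer (m + 1 - h₀) m)) ∧
      (∀ z : ℂ, z ≠ 0 → HasSum (fun m : ℕ => PowerSeries.coeff m K * z ^ m)
        (z ^ ((h₀ - 1) / 2) * Complex.Gamma (2 - h₀) *
          besselJ (1 - h₀) (2 * z ^ (1 / 2 : ℂ)))) := by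
  subst hh₀
  have : NeZero d := ⟨by omega⟩
  have hw : ∀ m : ℕ, (d + 2 * w₀ : ℂ) ≠ m + 2 := fun m hm => hw₀ (m + 2) (by omega) (by
    push_cast
    linear_combination hm / 2)
  refine ⟨solutionSeries (d + 2 * w₀), ?solves, ?unique, ?terms, ?constant,
    pochhammer_add_one_sub_ne_zero hw, coeff_solutionSeries _, fun z => hasSum_solutionSeries hw⟩
  case solves =>
    exact isFormalSolutionOperator_of_recursionDefect_eq_zero hI
      (constantCoeff_solutionSeries _) (recursionDefect_solutionSeries hw)
  case unique =>
    exact fun ⟨u, hu⟩ K hK => hK.eq_solutionSeries hI hw hu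
  case terms =>
    intro f₀ m g _ φ _ x hx
    simpa only [one_pow, mul_one] using coeff_solutionSeries_smul_wpow_yOp φ.open_target hx
      one_ne_zero (fun w f x _ => normIdotD_eq_neg_yOp w f x) _ _ w₀ (f₀.comp g φ) m
  case constant =>
    intro c hc f₀ m g hg φ hφ x hx
    exact coeff_solutionSeries_smul_wpow_yOp φ.open_target hx
      (hc g hg φ hφ x hx ▸ hI g hg φ hφ x hx)
      (fun w f x hx => hc g hg φ hφ x hx ▸ IdotD_eq_neg_scaleSq_smul_yOp (hI g hg φ hφ x hx) w f)
      _ _ w₀ (f₀.comp g φ) m
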